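/- Let $\mathbb K$ be $\mathbb R$ or $\mathbb C$ (the field from which amplitudes are taken). A real-time quantum finite automaton (QFA) over a finite alphabet $\Sigma$ consists of a finite state set $Q$, an initial state $q_1\in Q$, and, for each $\sigma\in\Sigma\cup\{\text{¢},\$\}$, finitely many matrices $E_{\sigma,1},\dots,E_{\sigma,k_\sigma}\in\mathbb K^{Q\times Q}$ with $\sum_i E_{\sigma,i}^\dagger E_{\sigma,i}=I$. On input $w\in\Sigma^*$ it starts in $\rho=|q_1\rangle\langle q_1|$, reads the string $\text{¢}w\$$ symbol by symbol, applying $\rho\mapsto\sum_i E_{\sigma,i}\,\rho\, E_{\sigma,i}^\dagger$ for each symbol $\sigma$, and ends in a state $\rho_w$; a set $S\subseteq Q$ is then observed with probability $\operatorname{tr}(P_S\rho_w)$, where $P_S=\sum_{q\in S}|q\rangle\langle q|$. A standard QFA has a set $Q_a\subseteq Q$ of accepting states and accepts $w$ with probability $\operatorname{tr}(P_{Q_a}\rho_w)$. A QFA with postselection has instead a partition $Q=Q_{pa}\sqcup Q_{pr}\sqcup Q_{nh}$ such that, with $p^a(w)=\operatorname{tr}(P_{Q_{pa}}\rho_w)$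 and $p^r(w)=\operatorname{tr}(P_{Q_{pr}}\rho_w)$, one has $p^a(w)+p^r(w)>0$ for every $w\in\Sigma^*$; it accepts $w$ with probability $\frac{p^a(w)}{p^a(w)+p^r(w)}$ and rejects $w$ with probability $\frac{p^r(w)}{p^a(w)+p^r(w)}$. A machine recognizes $L\subseteq\Sigma^*$ with cutpoint $0$ if $w\in L\iff P(\text{accept }w)>0$ for all $w\in\Sigma^*$; with error bound $\epsilon$ if $P(\text{accept }w)\ge 1-\epsilon$ for all $w\in L$ and $P(\text{reject }w)\ge 1-\epsilon$ for all $w\in\Sigma^*\setminus L$; with one-sided bounded error if it recognizes $L$ both with cutpoint $0$ and with some error bound $\epsilon\in[0,\tfrac12)$; and exactly if it recognizes $L$ with error bound $0$. Let $\mathsf{NQAL}$ be the class of languages (over finite alphabets) recognized with cutpoint $0$ by standard QFAs, $\mathsf{coNQAL}$ the class of languages whose complement is in $\mathsf{NQAL}$, and $\mathsf{PostRQAL}$ and $\mathsf{PostEQAL}$ the classes of languages recognized by QFAs with postselection with one-sided bounded error and exactly, respectively. Theorem. $\mathsf{PostEQAL}\subsetneq\mathsf{PostRQAL}\subseteq\mathsf{NQAL}$.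 More precisely, both inclusions hold among the languages over every finite alphabet, and the first one is proper already over $\{a,b\}$: for $L_{pal}=\{w\in\{a,b\}^*\mid w=w^r\}$, where $w^r$ is the reverse of $w$, the complement $\overline{L_{pal}}=\{a,b\}^*\setminus L_{pal}$ belongs to $\mathsf{PostRQAL}$ but not to $\mathsf{NQAL}\cap\mathsf{coNQAL}$, and $\mathsf{PostEQAL}$ restricted to languages over $\{a,b\}$ is a proper subset of $\mathsf{PostRQAL}$ restricted to such languages. -/

import Mathlib

/-- The symbols on the input tape: the letters of the input alphabet and the two end-markers. -/
inductive TapeSymbol (α : Type*) where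
  | left : TapeSymbol α
  | letter : α → TapeSymbol α
  | right : TapeSymbol α

/-- The string `¢ w $` that a real-time machine actually reads on input `w`. -/
def tape {α : Type*} (w : List α) : List (TapeSymbol α) :=
  TapeSymbol.left :: (w.map TapeSymbol.letter ++ [TapeSymbol.right])

/-- The part common to all real-time quantum finite automata over the input alphabet `α`,
with amplitudes in `𝕜`: a finite set of states, an initial state, and for each tape symbol `σ`
a finite collection of state transition matrices `E σ i` with `∑ i, (E σ i)ᴴ * E σ i = 1`. -/
structure QSystem (𝕜 : Type*) [RCLike 𝕜] (α : Type*) where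
  Q : Type
  [fintypeQ : Fintype Q]
  [decEqQ : DecidableEq Q]
  start : Q
  numOps : TapeSymbol α → ℕ
  E : (σ : TapeSymbol α) → Fin (numOps σ) → Matrix Q Q 𝕜
  wellFormed : ∀ σ, ∑ i, (E σ i).conjTranspose * E σ i = 1

attribute [instance] QSystem.fintypeQ QSystem.decEqQ

namespace QSystem

variable {𝕜 : Type*} [RCLike 𝕜] {α : Type*} (M : QSystem 𝕜 α)

/-- The superoperator `ρ ↦ ∑ i, E σ i * ρ * (E σ i)ᴴ` applied when `σ` is read. -/
def step (ρ : Matrix M.Q M.Q 𝕜) (σ : TapeSymbol α) : Matrix M.Q M.Q 𝕜 :=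
  ∑ i, M.E σ i * ρ * (M.E σ i).conjTranspose

/-- The density matrix `|q₁⟩⟨q₁|` of the initial state. -/
def initial : Matrix M.Q M.Q 𝕜 :=
  Matrix.single M.start M.start 1

/-- The density matrix of the machine after the whole tape `¢ w $` has been read. -/
def final (w : List α) : Matrix M.Q M.Q 𝕜 :=
  (tape w).foldl M.step M.initial

open Classical in
/-- The projection `∑ q ∈ S, |q⟩⟨q|`. -/
noncomputable def proj (S : Set M.Q) : Matrix M.Q M.Q 𝕜 :=
  Matrix.diagonal (fun q => if q ∈ S then 1 else 0)

/-- The probability that the measurement at the end of the input yields a state in `S`. -/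
noncomputable def prob (S : Set M.Q) (w : List α) : ℝ :=
  RCLike.re (M.proj S * M.final w).trace

end QSystem

/-- A real-time quantum finite automaton: the states are partitioned into accepting and
rejecting (non-accepting) ones, and the state type is measured at the end of the input. -/
structure QFA (𝕜 : Type*) [RCLike 𝕜] (α : Type*) extends QSystem 𝕜 α where
  accepting : Set Q

/-- The probability that a real-time quantum finite automaton accepts `w`. -/
noncomputable def QFA.probAccept {𝕜 : Type*} [RCLike 𝕜] {α : Type*} (M : QFA 𝕜 α)
    (w : List α) : ℝ :=
  M.prob M.accepting w

/-- The types of states of a machine with postselection: postselection accept,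
postselection reject, and nonpostselection halting. -/
inductive PostOutcome where
  | pa
  | pr
  | nh

/-- A real-time quantum finite automaton with postselection. The function `outcome` gives the
partition of the states, and every input leads to a postselection state with nonzero
probability. -/
structure QFAP (𝕜 : Type*) [RCLike 𝕜] (α : Type*) extends QSystem 𝕜 α where
  outcome : Q → PostOutcome
  postselects : ∀ w : List α,
    0 < toQSystem.prob {q | outcome q = PostOutcome.pa} w +
      toQSystem.prob {q | outcome q = PostOutcome.pr} w

namespace QFAP

variable {𝕜 : Type*} [RCLike 𝕜] {α : Type*} (M : QFAP 𝕜 α)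

/-- Acceptance probability before postselection. -/
noncomputable def preAccept (w : List α) : ℝ :=
  M.prob {q | M.outcome q = PostOutcome.pa} w

/-- Rejection probability before postselection. -/
noncomputable def preReject (w : List α) : ℝ :=
  M.prob {q | M.outcome q = PostOutcome.pr} w

/-- Overall acceptance probability, obtained by normalization. -/
noncomputable def probAccept (w : List α) : ℝ :=
  M.preAccept w / (M.preAccept w + M.preReject w)

/-- Overall rejection probability, obtained by normalization. -/
noncomputable def probReject (w : List α) : ℝ :=
  M.preReject w / (M.preAccept w + M.preReject w)

end QFAP

/-- Recognition with (strict) cutpoint `c` by a machine whose acceptance probabilities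
are `acc`. -/
def RecognizesWithCutpoint {α : Type*} (acc : List α → ℝ) (c : ℝ) (L : Language α) : Prop :=
  ∀ w : List α, w ∈ L ↔ c < acc w

/-- Recognition with error bound `ε` by a machine with acceptance and rejection
probabilities `acc` and `rej`. -/
def RecognizesWithError {α : Type*} (acc rej : List α → ℝ) (ε : ℝ) (L : Language α) : Prop :=
  (∀ w ∈ L, 1 - ε ≤ acc w) ∧ (∀ w ∉ L, 1 - ε ≤ rej w)

/-- One-sided bounded error: recognition with cutpoint `0` and with some error bound in
`[0, 1/2)`, by one and the same machine. -/
def RecognizesOneSided {α : Type*} (acc rej : List α → ℝ) (L : Language α) : Prop :=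
  RecognizesWithCutpoint acc 0 L ∧
    ∃ ε : ℝ, 0 ≤ ε ∧ ε < 1 / 2 ∧ RecognizesWithError acc rej ε L

/-- Error-free (exact) recognition: error bound `0`. -/
def RecognizesExactly {α : Type*} (acc rej : List α → ℝ) (L : Language α) : Prop :=
  RecognizesWithError acc rej 0 L

/-- Languages over `α` recognized with cutpoint `0` by real-time QFAs. -/
def NQAL (𝕜 : Type*) [RCLike 𝕜] (α : Type*) : Set (Language α) :=
  {L | ∃ M : QFA 𝕜 α, RecognizesWithCutpoint M.probAccept 0 L}

/-- Languages over `α` whose complement is in `NQAL`. -/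
def coNQAL (𝕜 : Type*) [RCLike 𝕜] (α : Type*) : Set (Language α) :=
  {L | Lᶜ ∈ NQAL 𝕜 α}

/-- Languages over `α` recognized with one-sided bounded error by real-time QFAs with
postselection. -/
def PostRQAL (𝕜 : Type*) [RCLike 𝕜] (α : Type*) : Set (Language α) :=
  {L | ∃ M : QFAP 𝕜 α, RecognizesOneSided M.probAccept M.probReject L}

/-- Languages over `α` recognized without error by real-time QFAs with postselection. -/
def PostEQAL (𝕜 : Type*) [RCLike 𝕜] (α : Type*) : Set (Language α) :=
  {L | ∃ M : QFAP 𝕜 α, RecognizesExactly M.probAccept M.probReject L}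

/-- The two-letter alphabet `{a, b}`. -/
inductive Letter where
  | a
  | b

/-- The palindrome language over `{a, b}`. -/
def palindromes : Language Letter :=
  {w : List Letter | w = w.reverse}

/-! Both inclusions keep the machine: error `0` forces acceptance probability `0` off the language,
and dividing by a positive total does not change whether an acceptance probability is positive.
Swapping accept and reject makes exact recognition closed under complement, so `PostEQAL` lies in
`NQAL ∩ coNQAL`, and properness needs only two facts about palindromes. They are not in `NQAL`
(`palindromes_notMem_NQAL`): the words `a^i b a^j` would make infinitely many states linearly
independent in a finite-dimensional space of matrices (`not_forall_prob_pos_iff`). Their complement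
is in `PostRQAL`: any linear automaton with a nowhere vanishing reject amplitude can be simulated,
since postselection cancels the rescaling of its matrices (`exists_QFAP_of_linear`). One such
automaton compares the binary values of `w` and its reverse; these are integers, so distinct values
leave a gap. -/

open scoped Matrix ComplexOrder

/-! ### Positivity, linearity and fooling sets -/

namespace QSystem

variable {𝕜 : Type*} [RCLike 𝕜] {α : Type*} (M : QSystem 𝕜 α)

open Classical in
theorem prob_eq_sum (S : Set M.Q) (w : List α) :
    M.prob S w = ∑ q, if q ∈ S then RCLike.re (M.final w q q) else 0 := by
  simp only [prob, proj, Matrix.trace, Matrix.diag_apply, Matrix.diagonal_mul, map_sum]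
  refine Finset.sum_congr rfl fun q _ => ?_
  split_ifs <;> simp

theorem prob_singleton (q : M.Q) (w : List α) : M.prob {q} w = RCLike.re (M.final w q q) := by
  simp [prob_eq_sum]

theorem posSemidef_step {ρ : Matrix M.Q M.Q 𝕜} (hρ : ρ.PosSemidef) (σ : TapeSymbol α) :
    (M.step ρ σ).PosSemidef :=
  Matrix.posSemidef_sum _ fun i _ => hρ.mul_mul_conjTranspose_same (M.E σ i)

theorem posSemidef_initial : (M.initial).PosSemidef := by
  have h : M.initial = Matrix.diagonal (Pi.single M.start (1 : 𝕜)) := by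
    rw [initial, Matrix.diagonal_single]
  rw [h]
  refine Matrix.PosSemidef.diagonal fun q => ?_
  by_cases hq : q = M.start
  · subst hq; simp
  · simp [hq]

theorem posSemidef_foldl_step (l : List (TapeSymbol α)) {ρ : Matrix M.Q M.Q 𝕜}
    (hρ : ρ.PosSemidef) : (l.foldl M.step ρ).PosSemidef := by
  induction l generalizing ρ with
  | nil => exact hρ
  | cons σ l ih => exact ih (M.posSemidef_step hρ σ)

theorem prob_nonneg (S : Set M.Q) (w : List α) : 0 ≤ M.prob S w := by
  classical
  rw [prob_eq_sum]
  refine Finset.sum_nonneg fun q _ => ?_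
  split_ifs
  · exact (RCLike.nonneg_iff.1
      ((M.posSemidef_foldl_step (tape w) M.posSemidef_initial).diag_nonneg)).1
  · exact le_rfl

/-- The superoperator of a tape symbol as a real-linear map. -/
noncomputable def stepₗ (σ : TapeSymbol α) : Matrix M.Q M.Q 𝕜 →ₗ[ℝ] Matrix M.Q M.Q 𝕜 where
  toFun ρ := M.step ρ σ
  map_add' ρ τ := by simp [step, mul_add, add_mul, Finset.sum_add_distrib]
  map_smul' c ρ := by simp [step, Finset.smul_sum]

/-- Reading a string of tape symbols, as a real-linear map. -/
noncomputable def runₗ : List (TapeSymbol α) → Matrix M.Q M.Q 𝕜 →ₗ[ℝ] Matrix M.Q M.Q 𝕜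
  | [] => LinearMap.id
  | σ :: l => runₗ l ∘ₗ M.stepₗ σ

theorem runₗ_apply (l : List (TapeSymbol α)) (ρ : Matrix M.Q M.Q 𝕜) :
    M.runₗ l ρ = l.foldl M.step ρ := by
  induction l generalizing ρ with
  | nil => rfl
  | cons σ l ih => exact ih (M.step ρ σ)

/-- The probability of observing `S` after the suffix `v` of the input and the right end-marker
have been read, as a linear functional of the current state. -/
noncomputable def suffixProb (S : Set M.Q) (v : List α) : Matrix M.Q M.Q 𝕜 →ₗ[ℝ] ℝ :=
  RCLike.reLm ∘ₗ Matrix.traceLinearMap M.Q ℝ 𝕜 ∘ₗ LinearMap.mulLeft ℝ (M.proj S) ∘ₗ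
    M.runₗ (v.map TapeSymbol.letter ++ [TapeSymbol.right])

/-- Cutting the run after `u` separates the variables: the functional depends only on `v`, the state
only on `u`. -/
theorem prob_append (S : Set M.Q) (u v : List α) :
    M.prob S (u ++ v) = M.suffixProb S v
      ((TapeSymbol.left :: u.map TapeSymbol.letter).foldl M.step M.initial) := by
  simp [prob, suffixProb, final, tape, runₗ_apply]

/-- A fooling set for recognition with cutpoint zero is finite. -/
theorem not_forall_prob_pos_iff {ι : Type*} [Infinite ι] (S : Set M.Q) (u v : ι → List α) :
    ¬ ∀ i j, 0 < M.prob S (u i ++ v j) ↔ i = j := by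
  intro h
  set ρ : ι → Matrix M.Q M.Q 𝕜 := fun i =>
    (TapeSymbol.left :: (u i).map TapeSymbol.letter).foldl M.step M.initial with hρ
  have hne : ∀ i j, i ≠ j → M.suffixProb S (v j) (ρ i) = 0 := fun i j hij => by
    rw [hρ, ← prob_append]
    -- Cutpoint zero matters here: a probability that is not positive is exactly zero.
    exact le_antisymm (not_lt.1 fun hlt => hij ((h i j).1 hlt)) (M.prob_nonneg S _)
  have heq : ∀ i, M.suffixProb S (v i) (ρ i) ≠ 0 := fun i => by
    rw [hρ, ← prob_append]
    exact ((h i i).2 rfl).ne'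
  -- The functionals `M.suffixProb S (v i)` are biorthogonal to the states up to nonzero factors.
  have hli : LinearIndependent ℝ ρ := by
    rw [linearIndependent_iff']
    intro s g hg i hi
    have h0 := congrArg (M.suffixProb S (v i)) hg
    rw [map_sum, map_zero, Finset.sum_eq_single_of_mem i hi] at h0
    · rw [map_smul, smul_eq_mul] at h0
      exact (mul_eq_zero.1 h0).resolve_right (heq i)
    · intro j _ hji
      rw [map_smul, hne j i hji, smul_zero]
  have : Finite ι := hli.finite
  exact not_finite ι

end QSystem

/-! ### Postselection and the formal inclusions -/

namespace QFAP

variable {𝕜 : Type*} [RCLike 𝕜] {α : Type*} (M : QFAP 𝕜 α)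

theorem preAccept_add_preReject_pos (w : List α) : 0 < M.preAccept w + M.preReject w :=
  M.postselects w

theorem probAccept_add_probReject (w : List α) : M.probAccept w + M.probReject w = 1 := by
  rw [probAccept, probReject, ← add_div, div_self (M.preAccept_add_preReject_pos w).ne']

theorem probAccept_pos_iff (w : List α) : 0 < M.probAccept w ↔ 0 < M.preAccept w :=
  div_pos_iff_of_pos_right (M.preAccept_add_preReject_pos w)

end QFAP

/-- Exchange of acceptance and rejection. -/
def PostOutcome.swap : PostOutcome → PostOutcome
  | pa => pr
  | pr => pa
  | nh => nh

theorem PostOutcome.swap_eq_pa {o : PostOutcome} : o.swap = pa ↔ o = pr := by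
  cases o <;> simp [swap]

theorem PostOutcome.swap_eq_pr {o : PostOutcome} : o.swap = pr ↔ o = pa := by
  cases o <;> simp [swap]

section Classes

variable {𝕜 : Type*} [RCLike 𝕜] {α : Type*}

/-- The machine with postselection in which acceptance and rejection are exchanged. -/
def QFAP.swap (M : QFAP 𝕜 α) : QFAP 𝕜 α where
  toQSystem := M.toQSystem
  outcome q := (M.outcome q).swap
  postselects w := by
    simp only [PostOutcome.swap_eq_pa, PostOutcome.swap_eq_pr]
    rw [add_comm]
    exact M.postselects w

theorem QFAP.preAccept_swap (M : QFAP 𝕜 α) (w : List α) : M.swap.preAccept w = M.preReject w := by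
  simp only [preAccept, preReject, swap, PostOutcome.swap_eq_pa]

theorem QFAP.preReject_swap (M : QFAP 𝕜 α) (w : List α) : M.swap.preReject w = M.preAccept w := by
  simp only [preAccept, preReject, swap, PostOutcome.swap_eq_pr]

theorem QFAP.probAccept_swap (M : QFAP 𝕜 α) (w : List α) :
    M.swap.probAccept w = M.probReject w := by
  rw [probAccept, probReject, preAccept_swap, preReject_swap, add_comm]

theorem QFAP.probReject_swap (M : QFAP 𝕜 α) (w : List α) :
    M.swap.probReject w = M.probAccept w := by
  rw [probAccept, probReject, preAccept_swap, preReject_swap, add_comm]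

theorem compl_mem_PostEQAL {L : Language α} (hL : L ∈ PostEQAL 𝕜 α) : Lᶜ ∈ PostEQAL 𝕜 α := by
  obtain ⟨M, hacc, hrej⟩ := hL
  refine ⟨M.swap, fun w hw => ?_, fun w hw => ?_⟩
  · rw [QFAP.probAccept_swap]
    exact hrej w hw
  · rw [QFAP.probReject_swap]
    exact hacc w (not_not.1 hw)

theorem PostEQAL_subset_PostRQAL : PostEQAL 𝕜 α ⊆ PostRQAL 𝕜 α := by
  rintro L ⟨M, hM⟩
  refine ⟨M, fun w => ⟨fun hw => ?_, fun hw => ?_⟩, 0, le_rfl, by norm_num, hM⟩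
  · linarith [hM.1 w hw]
  · by_contra hn
    linarith [hM.2 w hn, M.probAccept_add_probReject w]

theorem PostRQAL_subset_NQAL : PostRQAL 𝕜 α ⊆ NQAL 𝕜 α := by
  rintro L ⟨M, hM, -⟩
  exact ⟨⟨M.toQSystem, {q | M.outcome q = PostOutcome.pa}⟩, fun w =>
    (hM w).trans (M.probAccept_pos_iff w)⟩

theorem PostEQAL_subset_NQAL_inter_coNQAL : PostEQAL 𝕜 α ⊆ NQAL 𝕜 α ∩ coNQAL 𝕜 α := fun _ hL =>
  ⟨PostRQAL_subset_NQAL (PostEQAL_subset_PostRQAL hL),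
    PostRQAL_subset_NQAL (PostEQAL_subset_PostRQAL (compl_mem_PostEQAL hL))⟩

end Classes

/-! ### Palindromes are not in `NQAL` -/

theorem replicate_append_cons_mem_palindromes (i j : ℕ) :
    List.replicate i Letter.a ++ Letter.b :: List.replicate j Letter.a ∈ palindromes ↔ i = j := by
  change _ = List.reverse _ ↔ _
  simp only [List.reverse_append, List.reverse_cons, List.reverse_replicate, List.append_assoc,
    List.singleton_append]
  refine ⟨fun h => ?_, fun h => h ▸ rfl⟩
  -- The position of the only `b` recovers the first exponent; reversal exchanges the exponents.
  have key (k l : ℕ) :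
      (List.replicate k Letter.a ++ Letter.b :: List.replicate l Letter.a).findIdx
        (fun x => match x with | .a => false | .b => true) = k := by
    induction k with
    | zero => simp [List.findIdx_cons]
    | succ k ih => simp [List.replicate_succ, List.findIdx_cons, ih]
  rw [← key i j, h, key j i]

theorem palindromes_notMem_NQAL (𝕜 : Type*) [RCLike 𝕜] : palindromes ∉ NQAL 𝕜 Letter := by
  rintro ⟨M, hM⟩
  exact M.not_forall_prob_pos_iff M.accepting (fun i : ℕ => List.replicate i Letter.a)
    (fun j => Letter.b :: List.replicate j Letter.a) fun i j =>
      (hM _).symm.trans (replicate_append_cons_mem_palindromes i j)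

/-! ### Simulating linear automata with postselection -/

/-- The partition of the states `n ⊕ n` that postselects on two states of the left copy. -/
def dilationOutcome {n : Type*} [DecidableEq n] (qa qr : n) : n ⊕ n → PostOutcome :=
  Sum.elim (fun q => if q = qa then .pa else if q = qr then .pr else .nh) fun _ => .nh

theorem dilationOutcome_eq_pa {n : Type*} [DecidableEq n] {qa qr : n} (q : n ⊕ n) :
    dilationOutcome qa qr q = PostOutcome.pa ↔ q = Sum.inl qa := by
  rcases q with q | q <;> simp only [dilationOutcome, Sum.elim_inl, Sum.elim_inr] <;> grind

theorem dilationOutcome_eq_pr {n : Type*} [DecidableEq n] {qa qr : n} (hne : qa ≠ qr)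
    (q : n ⊕ n) :
    dilationOutcome qa qr q = PostOutcome.pr ↔ q = Sum.inl qr := by
  rcases q with q | q <;> simp only [dilationOutcome, Sum.elim_inl, Sum.elim_inr] <;> grind

section LinearAutomaton

variable {𝕜 : Type*} [RCLike 𝕜] {α : Type*} {n : Type} [Fintype n]

/-- The vector reached by a linear automaton with transition matrices `A`. -/
def linearRun (A : TapeSymbol α → Matrix n n 𝕜) (x : n → 𝕜) (l : List (TapeSymbol α)) : n → 𝕜 :=
  l.foldl (fun v σ => A σ *ᵥ v) x

/-- All coordinates acquire the same factor, which depends only on the word read, so ratios of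
amplitudes survive rescaling by nonzero `c σ`. -/
theorem linearRun_smul (A : TapeSymbol α → Matrix n n 𝕜) (c : TapeSymbol α → ℝ) (x : n → 𝕜) (a : ℝ) (l : List (TapeSymbol α)) :
    linearRun (fun σ => c σ • A σ) (a • x) l = (a * (l.map c).prod) • linearRun A x l := by
  induction l generalizing x a with
  | nil => simp [linearRun]
  | cons σ l ih =>
    have := ih (A σ *ᵥ x) (a * c σ)
    simp only [linearRun, List.foldl_cons, List.map_cons, List.prod_cons] at this ⊢
    rw [← mul_assoc, ← this, Matrix.smul_mulVec, Matrix.mulVec_smul, smul_smul, mul_comm]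

theorem coe_norm_toLp_sq (x : n → 𝕜) : ((‖WithLp.toLp 2 x‖ ^ 2 : ℝ) : 𝕜) = star x ⬝ᵥ x := by
  simp [EuclideanSpace.norm_sq_eq, dotProduct, RCLike.conj_mul]

variable [DecidableEq n]

open scoped Matrix.Norms.L2Operator in
-- The quadratic form at `x` is `‖x‖² - ‖C x‖²`.
theorem posSemidef_one_sub_conjTranspose_mul_self {C : Matrix n n 𝕜} (hC : ‖C‖ ≤ 1) :
    (1 - Cᴴ * C).PosSemidef := by
  refine Matrix.PosSemidef.of_dotProduct_mulVec_nonneg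
    (Matrix.isHermitian_one.sub (Matrix.isHermitian_conjTranspose_mul_self C)) fun x => ?_
  have hle : ‖WithLp.toLp 2 (C *ᵥ x)‖ ≤ ‖WithLp.toLp 2 x‖ :=
    (C.l2_opNorm_mulVec (WithLp.toLp 2 x)).trans (mul_le_of_le_one_left (norm_nonneg _) hC)
  rw [Matrix.sub_mulVec, Matrix.one_mulVec, dotProduct_sub, ← Matrix.mulVec_mulVec,
    Matrix.dotProduct_mulVec, ← Matrix.star_mulVec, ← coe_norm_toLp_sq, ← coe_norm_toLp_sq,
    sub_nonneg]
  exact_mod_cast pow_le_pow_left₀ (norm_nonneg _) hle 2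

open scoped Matrix.Norms.L2Operator MatrixOrder in
/-- Every square matrix is, up to a positive scalar, a member of a pair of Kraus operators. -/
theorem exists_smul_conjTranspose_mul_self_add_eq_one (A : Matrix n n 𝕜) :
    ∃ c : ℝ, 0 < c ∧ ∃ B : Matrix n n 𝕜, (c • A)ᴴ * (c • A) + Bᴴ * B = 1 := by
  have hpos : 0 < 1 + ‖A‖ := by positivity
  -- This scalar makes `A` a contraction; the summand `1` covers `A = 0`.
  refine ⟨(1 + ‖A‖)⁻¹, inv_pos.2 hpos, ?_⟩
  have hnorm : ‖(1 + ‖A‖)⁻¹ • A‖ ≤ 1 := by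
    rw [RCLike.real_smul_eq_coe_smul (K := 𝕜), norm_smul, RCLike.norm_ofReal,
      abs_of_pos (inv_pos.2 hpos), inv_mul_le_one₀ hpos]
    linarith
  obtain ⟨B, hB⟩ := CStarAlgebra.nonneg_iff_eq_star_mul_self.1
    (posSemidef_one_sub_conjTranspose_mul_self hnorm).nonneg
  exact ⟨B, by rw [← Matrix.star_eq_conjTranspose B, ← hB, add_sub_cancel]⟩

/-- Kraus operators that apply `A σ` on the left copy of the state set, and send what `A σ` loses
to the right copy. -/
def dilationOps (A B : TapeSymbol α → Matrix n n 𝕜) (σ : TapeSymbol α) :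
    Fin 3 → Matrix (n ⊕ n) (n ⊕ n) 𝕜 :=
  ![Matrix.fromBlocks (A σ) 0 0 0, Matrix.fromBlocks 0 0 (B σ) 0, Matrix.fromBlocks 0 0 0 1]

/-- The quantum system that simulates a linear automaton with transition matrices `A` on the left
copy of the state set, and diverts the rest of the probability to the right copy. -/
def dilation (A B : TapeSymbol α → Matrix n n 𝕜) (h : ∀ σ, (A σ)ᴴ * A σ + (B σ)ᴴ * B σ = 1)
    (q₀ : n) : QSystem 𝕜 α where
  Q := n ⊕ n
  start := Sum.inl q₀
  numOps _ := 3
  E := dilationOps A B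
  wellFormed σ := by
    simp [dilationOps, Fin.sum_univ_three, Matrix.fromBlocks_conjTranspose,
      Matrix.fromBlocks_multiply, Matrix.fromBlocks_add, h]

variable {A B : TapeSymbol α → Matrix n n 𝕜} (h : ∀ σ, (A σ)ᴴ * A σ + (B σ)ᴴ * B σ = 1) (q₀ : n)

/-- Only the first Kraus operator has output in the left copy, and it reads only the left copy.
Nothing flows back from the right, so a pure left block stays pure. -/
theorem dilation_foldl_step_inl (l : List (TapeSymbol α)) (ρ : Matrix (n ⊕ n) (n ⊕ n) 𝕜)
    (x : n → 𝕜) (hρ : ρ.toBlocks₁₁ = Matrix.vecMulVec x (star x)) :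
    Matrix.toBlocks₁₁ (l.foldl (dilation A B h q₀).step ρ : Matrix (n ⊕ n) (n ⊕ n) 𝕜) =
      Matrix.vecMulVec (linearRun A x l) (star (linearRun A x l)) := by
  induction l generalizing ρ x with
  | nil => exact hρ
  | cons σ l ih =>
    refine ih _ (A σ *ᵥ x) ?_
    have hstep : Matrix.toBlocks₁₁ ((dilation A B h q₀).step ρ σ : Matrix (n ⊕ n) (n ⊕ n) 𝕜) =
        A σ * ρ.toBlocks₁₁ * (A σ)ᴴ := by
      have hsum : (dilation A B h q₀).step ρ σ =
          (∑ i : Fin 3, dilationOps A B σ i * ρ * (dilationOps A B σ i)ᴴ :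
            Matrix (n ⊕ n) (n ⊕ n) 𝕜) := rfl
      rw [hsum, ← Matrix.fromBlocks_toBlocks ρ]
      simp [dilationOps, Fin.sum_univ_three, Matrix.fromBlocks_conjTranspose,
        Matrix.fromBlocks_multiply, Matrix.fromBlocks_add]
    rw [hstep, hρ, Matrix.mul_vecMulVec, Matrix.vecMulVec_mul, Matrix.star_mulVec]

theorem dilation_final_inl (w : List α) (q : n) :
    (dilation A B h q₀).final w (Sum.inl q) (Sum.inl q) =
      (‖linearRun A (Pi.single q₀ 1) (tape w) q‖ ^ 2 : ℝ) := by
  have := dilation_foldl_step_inl h q₀ (tape w) (dilation A B h q₀).initial (Pi.single q₀ 1) (by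
    ext i j
    change Matrix.single (Sum.inl q₀ : n ⊕ n) (Sum.inl q₀) (1 : 𝕜) (Sum.inl i) (Sum.inl j) = _
    simp [Matrix.single_apply, Matrix.vecMulVec_apply, Pi.single_apply]
    grind)
  have := congrFun (congrFun this q) q
  refine this.trans ?_
  simp [Matrix.vecMulVec_apply, RCLike.mul_conj]

theorem dilation_prob_singleton_inl (w : List α) (q : n) :
    (dilation A B h q₀).prob {Sum.inl q} w =
      ‖linearRun A (Pi.single q₀ 1) (tape w) q‖ ^ 2 := by
  exact (QSystem.prob_singleton _ _ w).trans (by rw [dilation_final_inl, RCLike.ofReal_re])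

/-- A linear automaton whose two distinguished amplitudes do not vanish simultaneously is simulated
by a machine with postselection. -/
theorem exists_QFAP_of_linear (A : TapeSymbol α → Matrix n n 𝕜) (q₀ qa qr : n) (hne : qa ≠ qr)
    (hA : ∀ w : List α, linearRun A (Pi.single q₀ 1) (tape w) qr ≠ 0) :
    ∃ M : QFAP 𝕜 α, ∀ w, ∃ s : ℝ, 0 < s ∧
      M.preAccept w = s * ‖linearRun A (Pi.single q₀ 1) (tape w) qa‖ ^ 2 ∧
      M.preReject w = s * ‖linearRun A (Pi.single q₀ 1) (tape w) qr‖ ^ 2 := by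
  choose c hc B hB using fun σ => exists_smul_conjTranspose_mul_self_add_eq_one (A σ)
  let N := dilation (fun σ => c σ • A σ) B hB q₀
  let out : N.Q → PostOutcome := dilationOutcome qa qr
  have hpa : {q : N.Q | out q = PostOutcome.pa} = {Sum.inl qa} := Set.ext dilationOutcome_eq_pa
  have hpr : {q : N.Q | out q = PostOutcome.pr} = {Sum.inl qr} :=
    Set.ext (dilationOutcome_eq_pr hne)
  -- Squared because probabilities are squared amplitudes.
  let s (w : List α) : ℝ := ((tape w).map c).prod ^ 2
  have hs (w : List α) : 0 < s w := by
    refine pow_pos (List.prod_pos fun x hx => ?_) 2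
    obtain ⟨σ, -, rfl⟩ := List.mem_map.1 hx
    exact hc σ
  have hprob (w : List α) (q : n) : N.prob {Sum.inl q} w =
      s w * ‖linearRun A (Pi.single q₀ 1) (tape w) q‖ ^ 2 := by
    have := linearRun_smul A c (Pi.single q₀ 1) 1 (tape w)
    rw [one_smul, one_mul] at this
    rw [dilation_prob_singleton_inl, this, Pi.smul_apply, norm_smul, mul_pow, Real.norm_eq_abs,
      sq_abs]
  refine ⟨⟨N, out, fun w => ?_⟩, fun w => ⟨s w, hs w, ?_, ?_⟩⟩
  · rw [hpa, hpr]
    refine add_pos_of_nonneg_of_pos (N.prob_nonneg _ _) ?_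
    rw [hprob]
    exact mul_pos (hs w) (pow_pos (norm_pos_iff.2 (hA w)) 2)
  · change N.prob {q | out q = PostOutcome.pa} w = _
    rw [hpa, hprob]
  · change N.prob {q | out q = PostOutcome.pr} w = _
    rw [hpr, hprob]

end LinearAutomaton

/-! ### A linear automaton for non-palindromes -/

/-- Binary digits encoding the letters. -/
def Letter.digit : Letter → ℕ
  | a => 0
  | b => 1

/-- The number whose binary digits, least significant first, are given by a word. -/
def binaryValue (w : List Letter) : ℕ :=
  Nat.ofDigits 2 (w.map Letter.digit)

/-- Trailing `a`s do not change the value, hence the length hypothesis, which a word and its reverse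
satisfy. -/
theorem binaryValue_inj {u v : List Letter} (hlen : u.length = v.length) :
    binaryValue u = binaryValue v ↔ u = v := by
  refine ⟨fun h => ?_, fun h => h ▸ rfl⟩
  have hlt (w : List Letter) : ∀ d ∈ w.map Letter.digit, d < 2 := by
    intro d hd
    obtain ⟨x, -, rfl⟩ := List.mem_map.1 hd
    cases x <;> simp [Letter.digit]
  have hinj : Function.Injective Letter.digit := by
    rintro (_ | _) (_ | _) <;> simp [Letter.digit]
  exact List.map_injective_iff.2 hinj
    (Nat.ofDigits_inj_of_len_eq one_lt_two (by simpa using hlen) (hlt u) (hlt v) h)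

theorem binaryValue_cons (x : Letter) (w : List Letter) :
    binaryValue (x :: w) = x.digit + 2 * binaryValue w := by
  simp [binaryValue, Nat.ofDigits_cons]

theorem binaryValue_concat (w : List Letter) (x : Letter) :
    binaryValue (w ++ [x]) = binaryValue w + 2 ^ w.length * x.digit := by
  simp [binaryValue, Nat.ofDigits_append]

/-- Transition matrices of a linear automaton that stores `1`, a power of two, and the binary values
of the reversed input and of the input, and that finally subtracts these values. -/
def palMatrix (𝕜 : Type*) [RCLike 𝕜] : TapeSymbol Letter → Matrix (Fin 4) (Fin 4) 𝕜
  | .left => !![1, 0, 0, 0; 1, 0, 0, 0; 0, 0, 0, 0; 0, 0, 0, 0]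
  | .letter x => !![1, 0, 0, 0; 0, 2, 0, 0; (x.digit : 𝕜), 0, 2, 0; 0, (x.digit : 𝕜), 0, 1]
  | .right => !![1, 0, 0, 0; 0, 0, 0, 0; 0, 0, 0, 0; 0, 0, 2, -2]

theorem linearRun_palMatrix (𝕜 : Type*) [RCLike 𝕜] (w : List Letter) :
    linearRun (palMatrix 𝕜) ![1, 1, 0, 0] (w.map TapeSymbol.letter) =
      ![1, 2 ^ w.length, (binaryValue w.reverse : 𝕜), (binaryValue w : 𝕜)] := by
  induction w using List.reverseRecOn with
  | nil => simp [linearRun, binaryValue]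
  | append_singleton w x ih =>
    rw [linearRun] at ih ⊢
    rw [List.map_append, List.foldl_append, ih, List.reverse_append]
    simp only [List.map_cons, List.map_nil, List.foldl_cons, List.foldl_nil, List.reverse_cons,
      List.reverse_nil, List.nil_append, List.singleton_append, binaryValue_cons,
      binaryValue_concat, List.length_append, List.length_singleton]
    ext i
    fin_cases i <;> simp [palMatrix] <;> ring

theorem linearRun_palMatrix_tape (𝕜 : Type*) [RCLike 𝕜] (w : List Letter) :
    linearRun (palMatrix 𝕜) (Pi.single 0 1) (tape w) =
      ![1, 0, 0, 2 * ((binaryValue w.reverse : 𝕜) - binaryValue w)] := by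
  have h0 : palMatrix 𝕜 .left *ᵥ Pi.single 0 1 = ![1, 1, 0, 0] := by
    ext i
    fin_cases i <;> simp [palMatrix]
  have := linearRun_palMatrix 𝕜 w
  rw [linearRun] at this ⊢
  rw [tape, List.foldl_cons, h0, List.foldl_append, this]
  ext i
  fin_cases i <;> simp [palMatrix]
  ring

theorem compl_palindromes_mem_PostRQAL (𝕜 : Type*) [RCLike 𝕜] :
    palindromesᶜ ∈ PostRQAL 𝕜 Letter := by
  obtain ⟨M, hM⟩ := exists_QFAP_of_linear (palMatrix 𝕜) 0 3 0 (by decide) fun w => by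
    simp [linearRun_palMatrix_tape]
  have key (w : List Letter) : (w ∈ palindromes ∧ M.probAccept w = 0 ∧ M.probReject w = 1) ∨
      (w ∉ palindromes ∧ 4 / 5 ≤ M.probAccept w) := by
    obtain ⟨s, hs, ha, hr⟩ := hM w
    have hsum := M.probAccept_add_probReject w
    simp only [linearRun_palMatrix_tape] at ha hr
    by_cases hw : w ∈ palindromes
    · have hw' : w.reverse = w := (show w = w.reverse from hw).symm
      have h0 : M.probAccept w = 0 := by
        rw [QFAP.probAccept, ha, hw']
        simp
      exact Or.inl ⟨hw, h0, by linarith⟩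
    · have hz : (binaryValue w.reverse : ℤ) - binaryValue w ≠ 0 := by
        rw [sub_ne_zero, Ne, Nat.cast_inj, binaryValue_inj w.length_reverse]
        exact fun h => hw (show w = w.reverse from h.symm)
      have hcast : (binaryValue w.reverse : 𝕜) - binaryValue w =
          (((binaryValue w.reverse : ℤ) - binaryValue w : ℤ) : ℝ) := by
        push_cast
        rfl
      set D : ℤ := (binaryValue w.reverse : ℤ) - binaryValue w
      -- Integrality provides the gap that bounds the error.
      have hD : (1 : ℝ) ≤ (D : ℝ) ^ 2 := by
        have : 1 ≤ D ^ 2 := Int.add_one_le_iff.2 (sq_pos_iff.2 hz)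
        exact_mod_cast this
      have ha' : M.preAccept w = s * (4 * (D : ℝ) ^ 2) := by
        rw [ha, hcast]
        simp only [Matrix.cons_val, norm_mul, RCLike.norm_ofNat, RCLike.norm_ofReal, mul_pow, sq_abs]
        norm_num
      have hr' : M.preReject w = s := by simpa using hr
      refine Or.inr ⟨hw, ?_⟩
      -- The acceptance probability is `4 D² / (4 D² + 1)`, at least `4/5`. Without the factor `2`
      -- in the final matrix, `D² = 1` would give only `1/2`.
      rw [QFAP.probAccept, le_div_iff₀ (M.preAccept_add_preReject_pos w), ha', hr']
      nlinarith
  refine ⟨M, fun w => ?_, 1 / 5, by norm_num, by norm_num, fun w hw => ?_, fun w hw => ?_⟩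
  · rcases key w with ⟨h, h0, -⟩ | ⟨h, h1⟩
    · exact ⟨fun hn => absurd h hn, fun hlt => absurd h0 hlt.ne'⟩
    · exact ⟨fun _ => by linarith, fun _ => h⟩
  · rcases key w with ⟨h, -⟩ | ⟨-, h1⟩
    · exact absurd h hw
    · linarith
  · rcases key w with ⟨-, -, h1⟩ | ⟨h, -⟩
    · linarith
    · exact absurd h hw

theorem compl_palindromes_notMem_NQAL_inter_coNQAL (𝕜 : Type*) [RCLike 𝕜] :
    palindromesᶜ ∉ NQAL 𝕜 Letter ∩ coNQAL 𝕜 Letter := by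
  rintro ⟨-, h⟩
  rw [coNQAL, Set.mem_ofPred_eq, compl_compl] at h
  exact palindromes_notMem_NQAL 𝕜 h

theorem mainTheorem9 (𝕜 : Type*) [RCLike 𝕜] :
    (∀ (α : Type*) [Finite α],
      PostEQAL 𝕜 α ⊆ PostRQAL 𝕜 α ∧ PostRQAL 𝕜 α ⊆ NQAL 𝕜 α) ∧
    PostEQAL 𝕜 Letter ⊂ PostRQAL 𝕜 Letter ∧
    palindromesᶜ ∈ PostRQAL 𝕜 Letter ∧
    palindromesᶜ ∉ NQAL 𝕜 Letter ∩ coNQAL 𝕜 Letter :=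
  ⟨fun _ _ => ⟨PostEQAL_subset_PostRQAL, PostRQAL_subset_NQAL⟩,
    (Set.ssubset_iff_of_subset PostEQAL_subset_PostRQAL).2
      ⟨palindromesᶜ, compl_palindromes_mem_PostRQAL 𝕜, fun h =>
        compl_palindromes_notMem_NQAL_inter_coNQAL 𝕜 (PostEQAL_subset_NQAL_inter_coNQAL h)⟩,
    compl_palindromes_mem_PostRQAL 𝕜, compl_palindromes_notMem_NQAL_inter_coNQAL 𝕜⟩
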